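/- Let $X$ be a real or complex Hilbert space and let $A$, with domain $D(A)\subseteq X$, be the infinitesimal generator of a $C_0$-semigroup $(T(t))_{t\ge 0}$ of bounded linear operators on $X$ that is exponentially stable, i.e. there are $M_0\in\mathbb R$ and $\omega_0>0$ with $\|T(t)\|\le M_0e^{-\omega_0 t}$ for all $t\ge 0$. Let $f:X\to X$ be locally Lipschitz continuous with $f(0)=0$, and suppose that $f$ is Fréchet differentiable at $0$ with derivative zero. Suppose moreover that there are $\omega\in\mathbb R$ and a bounded, boundedly invertible, self-adjoint operator $Q$ on $X$ such that $$\langle x,QAx\rangle+\langle Ax,Qx\rangle\le\omega\|x\|^2\qquad\text{for all }x\in D(A).$$ Then the equation $$\dot x(t)=Ax(t)+f(x(t)),\qquad x(0)=x_0, \qquad (1)$$ is locally exponentially stable around zero: there are constants $\delta>0$, $M\in\mathbb R$ and $\alpha>0$ such that for every $x_0\in X$ with $\|x_0\|<\delta$ equation (1) has a mild solution $x$ on $[0,\infty)$, every mild solution of (1) on an interval $[0,\tau)$ coincides with $x$ on $[0,\tau)$, and $$\|x(t)\|\le Me^{-\alpha t}\|x_0\|\qquad\text{for all }t\ge 0.$$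 Here a mild solution of (1) on an interval $J=[0,\infty)$ or $J=[0,\tau)$ is a continuous function $x:J\to X$ with $x(t)=T(t)x_0+\int_0^tT(t-s)f(x(s))\,ds$ for all $t\in J$. -/

import Mathlib

open Set Filter Topology

/-- `T` restricted to `[0, ∞)` is a `C₀`-semigroup of bounded linear operators on `X`
(the values of `T` at negative times play no role). -/
structure IsC0Semigroup {𝕜 X : Type*} [RCLike 𝕜] [NormedAddCommGroup X] [InnerProductSpace 𝕜 X]
    (T : ℝ → X →L[𝕜] X) : Prop where
  map_zero : T 0 = ContinuousLinearMap.id 𝕜 X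
  map_add : ∀ s t : ℝ, 0 ≤ s → 0 ≤ t → T (s + t) = (T s).comp (T t)
  tendsto_zero : ∀ x : X, Tendsto (fun t : ℝ => T t x) (𝓝[>] 0) (𝓝 x)

/-- The (in general unbounded) operator `A` is the infinitesimal generator of `T`: the pair `(x, y)`
lies in the graph of `A` exactly when `(T t x - x) / t → y` as `t ↓ 0`. In particular the domain
of `A` is the set of all `x` for which this limit exists. -/
def IsInfinitesimalGenerator {𝕜 X : Type*} [RCLike 𝕜] [NormedAddCommGroup X]
    [InnerProductSpace 𝕜 X] (A : X →ₗ.[𝕜] X) (T : ℝ → X →L[𝕜] X) : Prop :=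
  ∀ x y : X, (x, y) ∈ A.graph ↔
    Tendsto (fun t : ℝ => ((t⁻¹ : ℝ) : 𝕜) • (T t x - x)) (𝓝[>] 0) (𝓝 y)

/-- Exponential stability of a semigroup: `‖T t‖ ≤ M * exp (-ω₀ * t)` for all `t ≥ 0`,
for some `M` and some `ω₀ > 0`. -/
def IsExpStableSemigroup {𝕜 X : Type*} [RCLike 𝕜] [NormedAddCommGroup X] [InnerProductSpace 𝕜 X]
    (T : ℝ → X →L[𝕜] X) : Prop :=
  ∃ M ω₀ : ℝ, 0 < ω₀ ∧ ∀ t : ℝ, 0 ≤ t → ‖T t‖ ≤ M * Real.exp (-ω₀ * t)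

/-- `x` is a (mild) solution of `x' = A x + f x`, `x 0 = x₀`, on the interval of times `J`
(used for `J = [0, ∞)` and `J = [0, τ)`), where `A` generates the semigroup `T`:
`x` is continuous and satisfies the variation of constants formula. -/
def IsMildSolution {𝕜 X : Type*} [RCLike 𝕜] [NormedAddCommGroup X] [InnerProductSpace 𝕜 X]
    [NormedSpace ℝ X] (T : ℝ → X →L[𝕜] X) (f : X → X) (x₀ : X) (J : Set ℝ) (x : ℝ → X) : Prop :=
  ContinuousOn x J ∧
    ∀ t ∈ J, x t = T t x₀ + ∫ s in (0 : ℝ)..t, T (t - s) (f (x s))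

/-- Local exponential stability around zero of `x' = A x + f x`, where `A` generates `T`:
for all initial states in some ball around zero there is a global solution, it is the only
solution (on every interval `[0, τ)`), and it decays exponentially, with constants that do
not depend on the initial state. -/
def IsLocallyExpStable {𝕜 X : Type*} [RCLike 𝕜] [NormedAddCommGroup X] [InnerProductSpace 𝕜 X]
    [NormedSpace ℝ X] (T : ℝ → X →L[𝕜] X) (f : X → X) : Prop :=
  ∃ δ M α : ℝ, 0 < δ ∧ 0 < α ∧ ∀ x₀ : X, ‖x₀‖ < δ →
    ∃ x : ℝ → X, IsMildSolution T f x₀ (Ici 0) x ∧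
      (∀ τ : ℝ, ∀ y : ℝ → X, IsMildSolution T f x₀ (Ico 0 τ) y → EqOn y x (Ico 0 τ)) ∧
      ∀ t : ℝ, 0 ≤ t → ‖x t‖ ≤ M * Real.exp (-α * t) * ‖x₀‖

/-! Near zero the nonlinearity is dominated by an arbitrarily small multiple of the norm, `‖f x‖ ≤ ε
* ‖x‖`, because its derivative there vanishes. If `‖T t‖ ≤ M * exp (-ω * t)`, Grönwall applied to
`exp (ω * t) * ‖x t‖` shows that a mild solution obeying this bound decays at rate `ω - M * ε`,
which is positive for small `ε`.

Existence comes from composing `f` with the radial retraction onto a small ball: the result is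
globally Lipschitz, so a contraction argument gives a global solution. For small data the decay
estimate keeps it inside the ball, where the cut-off is inactive. A competing solution is trapped in
the same ball by continuity, and there Grönwall gives uniqueness. -/

section Gronwall

open MeasureTheory

/-- Grönwall's inequality in integral form, with constant coefficients. -/
theorem le_mul_exp_of_le_add_integral {φ : ℝ → ℝ} {C k t₀ : ℝ} (hk : 0 ≤ k)
    (hφ : ContinuousOn φ (Icc 0 t₀))
    (h : ∀ t ∈ Icc 0 t₀, φ t ≤ C + k * ∫ s in (0 : ℝ)..t, φ s) :
    ∀ t ∈ Icc 0 t₀, φ t ≤ C * Real.exp (k * t) := by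
  intro t ht
  have ht₀ : (0 : ℝ) ≤ t₀ := ht.1.trans ht.2
  -- Extending by the endpoint values gives a function continuous on the whole line, so its
  -- primitive is differentiable everywhere.
  set ψ : ℝ → ℝ := fun t => φ (projIcc 0 t₀ ht₀ t) with hψ
  have hψc : Continuous ψ :=
    (continuousOn_iff_continuous_domRestrict.1 hφ).comp continuous_projIcc
  have hψφ : ∀ s ∈ Icc 0 t₀, ψ s = φ s := fun s hs => by simp [hψ, projIcc_of_mem ht₀ hs]
  set I : ℝ → ℝ := fun t => ∫ s in (0 : ℝ)..t, ψ s with hI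
  have hId : ∀ t, HasDerivAt I (ψ t) t := fun t => hψc.integral_hasStrictDerivAt 0 t |>.hasDerivAt
  have hint : ∀ t ∈ Icc 0 t₀, ∫ s in (0 : ℝ)..t, φ s = I t := by
    intro t ht
    refine intervalIntegral.integral_congr fun s hs => ?_
    rw [uIcc_of_le ht.1] at hs
    exact (hψφ s ⟨hs.1, hs.2.trans ht.2⟩).symm
  -- Integrating factor: the hypothesis says exactly that this product has nonpositive derivative.
  set G : ℝ → ℝ := fun t => Real.exp (-k * t) * (C + k * I t) with hG
  have hGd : ∀ t, HasDerivAt G (k * Real.exp (-k * t) * (ψ t - (C + k * I t))) t := by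
    intro t
    have h1 : HasDerivAt (fun t => Real.exp (-k * t)) (Real.exp (-k * t) * (-k)) t := by
      simpa using ((hasDerivAt_id t).const_mul (-k)).exp
    have h2 : HasDerivAt (fun t => C + k * I t) (k * ψ t) t :=
      ((hId t).const_mul k).const_add C
    exact (h1.mul h2).congr_deriv (by ring)
  have hanti : AntitoneOn G (Icc 0 t₀) := by
    refine antitoneOn_of_deriv_nonpos (convex_Icc _ _)
      (fun t _ => (hGd t).continuousAt.continuousWithinAt)
      (fun t _ => (hGd t).differentiableAt.differentiableWithinAt) fun t ht => ?_
    have ht' : t ∈ Icc 0 t₀ := interior_subset ht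
    rw [(hGd t).deriv]
    have := h t ht'
    rw [hint t ht', ← hψφ t ht'] at this
    exact mul_nonpos_of_nonneg_of_nonpos (by positivity) (by linarith)
  have hG0 : G t ≤ C := by
    simpa [hG, hI] using hanti (left_mem_Icc.2 ht₀) ht ht.1
  have hb := h t ht
  rw [hint t ht] at hb
  calc φ t ≤ C + k * I t := hb
    _ = G t * Real.exp (k * t) := by
      simp only [hG]
      rw [mul_right_comm, ← Real.exp_add]
      simp
    _ ≤ C * Real.exp (k * t) := by gcongr

end Gronwall

/-! ### Cut-off by radial retraction -/

section RadialRetraction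

variable {X : Type*} [NormedAddCommGroup X] [NormedSpace ℝ X]

/-- The radial retraction of a normed space onto the closed ball of radius `r` around zero. -/
noncomputable def radialRetraction (r : ℝ) (x : X) : X := (r / max r ‖x‖) • x

theorem norm_radialRetraction_le_norm {r : ℝ} (hr : 0 < r) (x : X) :
    ‖radialRetraction r x‖ ≤ ‖x‖ := by
  have hm : 0 < max r ‖x‖ := lt_max_of_lt_left hr
  rw [radialRetraction, norm_smul, Real.norm_of_nonneg (by positivity)]
  exact mul_le_of_le_one_left (norm_nonneg _) ((div_le_one hm).2 (le_max_left _ _))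

theorem norm_radialRetraction_le {r : ℝ} (hr : 0 < r) (x : X) :
    ‖radialRetraction r x‖ ≤ r := by
  have hm : 0 < max r ‖x‖ := lt_max_of_lt_left hr
  rw [radialRetraction, norm_smul, Real.norm_of_nonneg (by positivity), div_mul_eq_mul_div,
    div_le_iff₀ hm]
  gcongr
  exact le_max_right _ _

theorem radialRetraction_of_norm_le {r : ℝ} (hr : 0 < r) {x : X} (hx : ‖x‖ ≤ r) :
    radialRetraction r x = x := by
  rw [radialRetraction, max_eq_left hx, div_self hr.ne', one_smul]

/-- Moving the point and changing the scaling factor each cost at most `‖x - y‖`, the latter because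
`max r ‖·‖` is 1-Lipschitz. -/
theorem norm_radialRetraction_sub_le {r : ℝ} (hr : 0 < r) (x y : X) :
    ‖radialRetraction r x - radialRetraction r y‖ ≤ 2 * ‖x - y‖ := by
  set a := max r ‖x‖ with ha
  set b := max r ‖y‖ with hb
  have ha0 : 0 < a := lt_max_of_lt_left hr
  have hb0 : 0 < b := lt_max_of_lt_left hr
  have hra : r / a ≤ 1 := (div_le_one ha0).2 (le_max_left _ _)
  have hyb : ‖y‖ / b ≤ 1 := (div_le_one hb0).2 (le_max_right _ _)
  have hab : |b - a| ≤ ‖x - y‖ := by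
    have := abs_max_sub_max_le_max r ‖y‖ r ‖x‖
    rw [sub_self, abs_zero, max_eq_right (abs_nonneg (‖y‖ - ‖x‖))] at this
    exact this.trans (by rw [norm_sub_rev]; exact abs_norm_sub_norm_le y x)
  have hsplit : radialRetraction r x - radialRetraction r y
      = (r / a) • (x - y) + (r / a - r / b) • y := by
    simp only [radialRetraction, ← ha, ← hb, smul_sub, sub_smul]
    abel
  have hcoef : ‖(r / a - r / b) • y‖ = (r / a) * (‖y‖ / b) * |b - a| := by
    have : r / a - r / b = r / a / b * (b - a) := by field_simp
    rw [norm_smul, this, Real.norm_eq_abs, abs_mul, abs_of_nonneg (by positivity)]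
    ring
  calc ‖radialRetraction r x - radialRetraction r y‖
      ≤ ‖(r / a) • (x - y)‖ + ‖(r / a - r / b) • y‖ := hsplit ▸ norm_add_le _ _
    _ = (r / a) * ‖x - y‖ + (r / a) * (‖y‖ / b) * |b - a| := by
      rw [hcoef, norm_smul, Real.norm_of_nonneg (by positivity)]
    _ ≤ 1 * ‖x - y‖ + 1 * ‖x - y‖ := by
      gcongr
      exact mul_le_one₀ hra (by positivity) hyb
    _ = 2 * ‖x - y‖ := by ring

end RadialRetraction

/-! ### Strong continuity and convolution estimates -/

section Semigroup

variable {𝕜 X : Type*} [RCLike 𝕜] [NormedAddCommGroup X] [InnerProductSpace 𝕜 X]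
  {T : ℝ → X →L[𝕜] X} {M : ℝ}

theorem IsC0Semigroup.norm_sub_le (hT : IsC0Semigroup T) (hM : ∀ t, 0 ≤ t → ‖T t‖ ≤ M)
    {s t : ℝ} (hs : 0 ≤ s) (ht : 0 ≤ t) (x : X) :
    ‖T t x - T s x‖ ≤ M * ‖T |t - s| x - x‖ := by
  wlog hst : s ≤ t generalizing s t
  · rw [norm_sub_rev, abs_sub_comm]
    exact this ht hs (le_of_not_ge hst)
  have hts : 0 ≤ t - s := sub_nonneg.2 hst
  have : T t x = T s (T (t - s) x) := by
    conv_lhs => rw [← add_sub_cancel s t, hT.map_add s (t - s) hs hts]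
    rfl
  rw [abs_of_nonneg hts, this, ← map_sub]
  exact (T s).le_of_opNorm_le (hM s hs) _

/-- Strong continuity at zero and the uniform bound give joint continuity. The clamp `max p.1 0` is
needed because `T` is arbitrary at negative times. -/
theorem IsC0Semigroup.continuous_uncurry (hT : IsC0Semigroup T)
    (hM : ∀ t, 0 ≤ t → ‖T t‖ ≤ M) :
    Continuous fun p : ℝ × X => T (max p.1 0) p.2 := by
  refine continuous_iff_continuousAt.2 fun ⟨s, x⟩ => ?_
  rw [ContinuousAt, tendsto_iff_norm_sub_tendsto_zero]
  have hx : Tendsto (fun h : ℝ => T |h| x) (𝓝 0) (𝓝 x) := by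
    have h0 : Tendsto (fun h : ℝ => T h x) (𝓝[≥] 0) (𝓝 x) := by
      have : ContinuousWithinAt (fun h : ℝ => T h x) (Ioi 0) 0 := by
        simpa [ContinuousWithinAt, hT.map_zero] using hT.tendsto_zero x
      simpa [ContinuousWithinAt, hT.map_zero] using continuousWithinAt_Ioi_iff_Ici.1 this
    refine h0.comp (tendsto_nhdsWithin_iff.2 ⟨?_, Eventually.of_forall fun h => abs_nonneg h⟩)
    simpa using (continuous_abs (G := ℝ)).tendsto 0
  have hlim : Tendsto (fun p : ℝ × X => M * ‖p.2 - x‖ + M * ‖T |max p.1 0 - max s 0| x - x‖)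
      (𝓝 (s, x)) (𝓝 0) := by
    have h1 : Tendsto (fun p : ℝ × X => M * ‖p.2 - x‖) (𝓝 (s, x)) (𝓝 0) := by
      have : Continuous fun p : ℝ × X => M * ‖p.2 - x‖ := by fun_prop
      simpa using this.tendsto (s, x)
    have h2 : Tendsto (fun p : ℝ × X => max p.1 0 - max s 0) (𝓝 (s, x)) (𝓝 0) := by
      have : Continuous fun p : ℝ × X => max p.1 0 - max s 0 := by fun_prop
      simpa using this.tendsto (s, x)
    have h3 := ((hx.comp h2).sub_const x).norm.const_mul M
    simpa using h1.add h3
  refine squeeze_zero (fun _ => norm_nonneg _) (fun p => ?_) hlim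
  calc ‖T (max p.1 0) p.2 - T (max s 0) x‖
      = ‖T (max p.1 0) (p.2 - x) + (T (max p.1 0) x - T (max s 0) x)‖ := by
        rw [map_sub]; congr 1; abel
    _ ≤ _ := (norm_add_le _ _).trans (add_le_add
        ((T _).le_of_opNorm_le (hM _ (le_max_right _ _)) _)
        (hT.norm_sub_le hM (le_max_right _ _) (le_max_right _ _) x))

theorem IsC0Semigroup.intervalIntegrable (hT : IsC0Semigroup T)
    (hM : ∀ t, 0 ≤ t → ‖T t‖ ≤ M) {φ : ℝ → X} {t : ℝ} (ht : 0 ≤ t)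
    (hφ : ContinuousOn φ (Icc 0 t)) :
    IntervalIntegrable (fun s => T (t - s) (φ s)) MeasureTheory.volume 0 t := by
  refine ContinuousOn.intervalIntegrable ?_
  rw [uIcc_of_le ht]
  have : ContinuousOn (fun s => T (max (t - s) 0) (φ s)) (Icc 0 t) :=
    (hT.continuous_uncurry hM).comp_continuousOn
      ((continuous_const.sub continuous_id).continuousOn.prodMk hφ)
  refine this.congr fun s hs => ?_
  simp only [max_eq_left (sub_nonneg.2 hs.2)]

variable [NormedSpace ℝ X]

theorem integral_semigroup_apply_eq_integral_max {φ : ℝ → X} {t : ℝ} (ht : 0 ≤ t) :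
    ∫ s in (0 : ℝ)..t, T (t - s) (φ s) = ∫ s in (0 : ℝ)..t, T (max (t - s) 0) (φ s) := by
  refine intervalIntegral.integral_congr fun s hs => ?_
  rw [uIcc_of_le ht] at hs
  simp only [max_eq_left (sub_nonneg.2 hs.2)]

theorem IsC0Semigroup.continuous_integral (hT : IsC0Semigroup T)
    (hM : ∀ t, 0 ≤ t → ‖T t‖ ≤ M) {φ : ℝ → X} (hφ : Continuous φ) :
    Continuous fun t : ℝ => ∫ s in (0 : ℝ)..t, T (max (t - s) 0) (φ s) := by
  refine intervalIntegral.continuous_parametric_intervalIntegral_of_continuous ?_ continuous_id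
  exact (hT.continuous_uncurry hM).comp
    (((continuous_fst.sub continuous_snd)).prodMk (hφ.comp continuous_snd))

/-- Pulling out `exp (-ω * t)` leaves an integrand independent of `t`, the form Grönwall requires.
-/
theorem norm_integral_semigroup_apply_le {ω : ℝ}
    (hM : ∀ t, 0 ≤ t → ‖T t‖ ≤ M * Real.exp (-ω * t)) {p : ℝ → X} {φ : ℝ → ℝ} {t : ℝ}
    (ht : 0 ≤ t) (hφ : ContinuousOn φ (Icc 0 t)) (h : ∀ s ∈ Icc 0 t, ‖p s‖ ≤ φ s) :
    ‖∫ s in (0 : ℝ)..t, T (t - s) (p s)‖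
      ≤ M * Real.exp (-ω * t) * ∫ s in (0 : ℝ)..t, Real.exp (ω * s) * φ s := by
  have hM0 : 0 ≤ M := by simpa using (norm_nonneg _).trans (hM 0 le_rfl)
  rw [← intervalIntegral.integral_const_mul]
  refine intervalIntegral.norm_integral_le_of_norm_le ht
    (Eventually.of_forall fun s hs => ?_) (ContinuousOn.intervalIntegrable ?_)
  · have hs' : s ∈ Icc 0 t := ⟨hs.1.le, hs.2⟩
    calc ‖T (t - s) (p s)‖ ≤ M * Real.exp (-ω * (t - s)) * ‖p s‖ :=
          (T _).le_of_opNorm_le (hM _ (sub_nonneg.2 hs.2)) _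
      _ ≤ M * Real.exp (-ω * (t - s)) * φ s := by gcongr; exact h s hs'
      _ = M * Real.exp (-ω * t) * (Real.exp (ω * s) * φ s) := by
        rw [show -ω * (t - s) = -ω * t + ω * s by ring, Real.exp_add]
        ring
  · rw [uIcc_of_le ht]
    exact continuousOn_const.mul ((by fun_prop : Continuous fun s => Real.exp (ω * s)).continuousOn.mul hφ)

end Semigroup

/-- A continuous function that is known to satisfy `‖y s‖ ≤ r'` at any time up to which it stayed in
the closed ball of radius `r > r'`, never leaves this ball. -/
theorem norm_le_of_trapped {E : Type*} [NormedAddCommGroup E] {y : ℝ → E} {r r' t₀ : ℝ} (hr : r' < r)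
    (hy : ContinuousOn y (Icc 0 t₀)) (hy0 : ‖y 0‖ ≤ r)
    (h : ∀ t ∈ Icc 0 t₀, (∀ s ∈ Icc 0 t, ‖y s‖ ≤ r) → ‖y t‖ ≤ r') :
    ∀ t ∈ Icc 0 t₀, ‖y t‖ ≤ r := by
  intro t₁ ht₁
  by_contra! hlt
  have hcross : ∀ s ∈ Icc 0 t₀, r < ‖y s‖ → ∃ c ∈ Icc 0 s, ‖y c‖ = r := fun s hs hrs =>
    intermediate_value_Icc hs.1 (hy.mono (Icc_subset_Icc_right hs.2)).norm ⟨hy0, hrs.le⟩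
  obtain ⟨c, hc, hcr⟩ := hcross t₁ ht₁ hlt
  -- Compactness provides a first time at which the norm equals `r`; up to then the path is in the
  -- ball, so `h` forces the norm below `r` there.
  have hcompact : IsCompact (Icc 0 t₀ ∩ (fun s => ‖y s‖) ⁻¹' {r}) :=
    isCompact_Icc.of_isClosed_subset
      (hy.norm.preimage_isClosed_of_isClosed isClosed_Icc isClosed_singleton) inter_subset_left
  obtain ⟨t, ⟨ht, htr⟩, hmin⟩ := hcompact.exists_isLeast ⟨c, ⟨hc.1, hc.2.trans ht₁.2⟩, hcr⟩
  have htr' : ‖y t‖ = r := htr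
  have := h t ht fun s hs => by
    by_contra! hrs
    obtain ⟨d, hd, hdr⟩ := hcross s ⟨hs.1, hs.2.trans ht.2⟩ hrs
    have htd : t ≤ d := hmin ⟨⟨hd.1, hd.2.trans (hs.2.trans ht.2)⟩, hdr⟩
    have hds : d = s := le_antisymm hd.2 (hs.2.trans htd)
    rw [← hds, hdr] at hrs
    exact lt_irrefl _ hrs
  linarith

/-! ### Mild solutions: growth, uniqueness, global existence -/

section MildSolution

variable {𝕜 X : Type*} [RCLike 𝕜] [NormedAddCommGroup X] [InnerProductSpace 𝕜 X]
  [NormedSpace ℝ X] {T : ℝ → X →L[𝕜] X} {M ω : ℝ} {f g : X → X} {x₀ : X} {J : Set ℝ}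
  {x y : ℝ → X}

theorem IsMildSolution.mono {J' : Set ℝ} (hx : IsMildSolution T f x₀ J x) (hJ : J' ⊆ J) :
    IsMildSolution T f x₀ J' x :=
  ⟨hx.1.mono hJ, fun t ht => hx.2 t (hJ ht)⟩

/-- If `f` grows at most linearly along a mild solution, the solution grows at most
exponentially. -/
theorem IsMildSolution.norm_le {ε t₀ : ℝ}
    (hM : ∀ t, 0 ≤ t → ‖T t‖ ≤ M * Real.exp (-ω * t)) (hε : 0 ≤ ε)
    (hx : IsMildSolution T f x₀ (Icc 0 t₀) x) (hfx : ∀ s ∈ Icc 0 t₀, ‖f (x s)‖ ≤ ε * ‖x s‖)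
    {t : ℝ} (ht : t ∈ Icc 0 t₀) :
    ‖x t‖ ≤ M * ‖x₀‖ * Real.exp ((M * ε - ω) * t) := by
  have hM0 : 0 ≤ M := by simpa using (norm_nonneg _).trans (hM 0 le_rfl)
  have hcont : ContinuousOn (fun s => Real.exp (ω * s) * ‖x s‖) (Icc 0 t₀) :=
    (by fun_prop : Continuous fun s => Real.exp (ω * s)).continuousOn.mul hx.1.norm
  have key : ∀ s ∈ Icc 0 t₀, Real.exp (ω * s) * ‖x s‖
      ≤ M * ‖x₀‖ + (M * ε) * ∫ r in (0 : ℝ)..s, Real.exp (ω * r) * ‖x r‖ := by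
    intro s hs
    have hsub : Icc 0 s ⊆ Icc 0 t₀ := Icc_subset_Icc_right hs.2
    have h1 := norm_integral_semigroup_apply_le hM hs.1 ((hx.1.mono hsub).norm.const_smul ε)
      fun r hr => hfx r (hsub hr)
    have h2 := (T s).le_of_opNorm_le (hM s hs.1) x₀
    have h3 : ∫ r in (0 : ℝ)..s, Real.exp (ω * r) * (ε • fun r => ‖x r‖) r
        = ε * ∫ r in (0 : ℝ)..s, Real.exp (ω * r) * ‖x r‖ := by
      rw [← intervalIntegral.integral_const_mul]
      congr 1; ext r; simp only [Pi.smul_apply, smul_eq_mul]; ring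
    have he : Real.exp (ω * s) * Real.exp (-ω * s) = 1 := by rw [← Real.exp_add]; simp
    rw [h3] at h1
    calc Real.exp (ω * s) * ‖x s‖
        ≤ Real.exp (ω * s) * (M * Real.exp (-ω * s) * ‖x₀‖ + M * Real.exp (-ω * s) *
            (ε * ∫ r in (0 : ℝ)..s, Real.exp (ω * r) * ‖x r‖)) := by
          gcongr
          rw [hx.2 s hs]
          exact (norm_add_le _ _).trans (add_le_add h2 h1)
      _ = Real.exp (ω * s) * Real.exp (-ω * s) * (M * ‖x₀‖ + (M * ε) *
            ∫ r in (0 : ℝ)..s, Real.exp (ω * r) * ‖x r‖) := by ring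
      _ = _ := by rw [he, one_mul]
  have hgr := le_mul_exp_of_le_add_integral (mul_nonneg hM0 hε) hcont key t ht
  calc ‖x t‖ = Real.exp (-ω * t) * (Real.exp (ω * t) * ‖x t‖) := by
        rw [← mul_assoc, ← Real.exp_add]; simp
    _ ≤ Real.exp (-ω * t) * (M * ‖x₀‖ * Real.exp (M * ε * t)) := by gcongr
    _ = M * ‖x₀‖ * Real.exp ((M * ε - ω) * t) := by
      rw [show (M * ε - ω) * t = -ω * t + M * ε * t by ring, Real.exp_add]; ring

/-- Two mild solutions with the same initial state coincide as long as they stay in a set on which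
`f` is Lipschitz. -/
theorem IsMildSolution.eqOn {K : NNReal} {S : Set X} {t₀ : ℝ} (hT : IsC0Semigroup T)
    (hM : ∀ t, 0 ≤ t → ‖T t‖ ≤ M) (hf : Continuous f) (hfS : LipschitzOnWith K f S)
    (hx : IsMildSolution T f x₀ (Icc 0 t₀) x) (hy : IsMildSolution T f x₀ (Icc 0 t₀) y)
    (hxS : MapsTo x (Icc 0 t₀) S) (hyS : MapsTo y (Icc 0 t₀) S) : EqOn x y (Icc 0 t₀) := by
  have hM0 : 0 ≤ M := (norm_nonneg _).trans (hM 0 le_rfl)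
  have hM' : ∀ t, 0 ≤ t → ‖T t‖ ≤ M * Real.exp (-0 * t) := by simpa using hM
  have hd : ContinuousOn (fun s => ‖x s - y s‖) (Icc 0 t₀) := (hx.1.sub hy.1).norm
  have key : ∀ s ∈ Icc 0 t₀, ‖x s - y s‖
      ≤ 0 + (M * K) * ∫ r in (0 : ℝ)..s, ‖x r - y r‖ := by
    intro s hs
    have hsub : Icc 0 s ⊆ Icc 0 t₀ := Icc_subset_Icc_right hs.2
    have hix : IntervalIntegrable (fun r => T (s - r) (f (x r))) MeasureTheory.volume 0 s :=
      hT.intervalIntegrable hM hs.1 (hf.comp_continuousOn (hx.1.mono hsub))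
    have hiy : IntervalIntegrable (fun r => T (s - r) (f (y r))) MeasureTheory.volume 0 s :=
      hT.intervalIntegrable hM hs.1 (hf.comp_continuousOn (hy.1.mono hsub))
    have hsplit : x s - y s = ∫ r in (0 : ℝ)..s, T (s - r) (f (x r) - f (y r)) := by
      simp only [map_sub]
      rw [hx.2 s hs, hy.2 s hs, add_sub_add_left_eq_sub, ← intervalIntegral.integral_sub hix hiy]
    have := norm_integral_semigroup_apply_le hM' hs.1 (p := fun r => f (x r) - f (y r))
      (φ := fun r => K * ‖x r - y r‖) (continuousOn_const.mul (hd.mono hsub))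
      fun r hr => hfS.norm_sub_le (hxS (hsub hr)) (hyS (hsub hr))
    rw [hsplit]
    simpa [mul_assoc] using this
  intro t ht
  have := le_mul_exp_of_le_add_integral (mul_nonneg hM0 K.2) hd key t ht
  rw [zero_mul] at this
  exact sub_eq_zero.1 (norm_le_zero_iff.1 this)

/-- Global existence of mild solutions for a globally Lipschitz nonlinearity. -/
theorem exists_isMildSolution_of_lipschitzWith [CompleteSpace X] {K : NNReal}
    (hT : IsC0Semigroup T) (hM : ∀ t, 0 ≤ t → ‖T t‖ ≤ M) (hg : LipschitzWith K g)
    (hg0 : g 0 = 0) (x₀ : X) : ∃ x : ℝ → X, IsMildSolution T g x₀ (Ici 0) x := by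
  have hM0 : 0 ≤ M := (norm_nonneg _).trans (hM 0 le_rfl)
  have hM' : ∀ t, 0 ≤ t → ‖T t‖ ≤ M * Real.exp (-0 * t) := by simpa using hM
  -- Weighted sup norm: with the unknown `u t = exp (-l * t) • x t`, the integral operator has
  -- Lipschitz constant at most `M * K / l ≤ 1 / 2` on all of `[0, ∞)` at once.
  set l : ℝ := 2 * (M * K) + 1 with hl
  have hl0 : 0 < l := by positivity
  have hKl : M * K / l ≤ 1 / 2 := by rw [div_le_iff₀ hl0]; linarith
  have hexp : ∀ t : ℝ, ∫ s in (0 : ℝ)..t, Real.exp (l * s) = (Real.exp (l * t) - 1) / l := by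
    intro t
    rw [intervalIntegral.integral_comp_mul_left _ hl0.ne']
    simp [integral_exp, div_eq_inv_mul]
  have hdiff : ∀ (v w : ℝ → X) (D : ℝ), Continuous v → Continuous w → 0 ≤ D →
      (∀ s, ‖v s - w s‖ ≤ D) → ∀ t : ℝ, 0 ≤ t →
      ‖Real.exp (-l * t) • ((∫ s in (0 : ℝ)..t, T (max (t - s) 0) (g (Real.exp (l * s) • v s)))
        - ∫ s in (0 : ℝ)..t, T (max (t - s) 0) (g (Real.exp (l * s) • w s)))‖ ≤ 1 / 2 * D := by
    intro v w D hv hw hD hvw t ht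
    have hcv : Continuous fun s => g (Real.exp (l * s) • v s) := hg.continuous.comp (by fun_prop)
    have hcw : Continuous fun s => g (Real.exp (l * s) • w s) := hg.continuous.comp (by fun_prop)
    rw [← integral_semigroup_apply_eq_integral_max (T := T) ht, ← integral_semigroup_apply_eq_integral_max (T := T) ht,
      ← intervalIntegral.integral_sub (hT.intervalIntegrable hM ht hcv.continuousOn)
        (hT.intervalIntegrable hM ht hcw.continuousOn)]
    simp only [← map_sub]
    have := norm_integral_semigroup_apply_le hM' ht
      (p := fun s => g (Real.exp (l * s) • v s) - g (Real.exp (l * s) • w s))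
      (φ := fun s => K * D * Real.exp (l * s)) (by fun_prop) fun s _ => by
        refine (hg.norm_sub_le _ _).trans ?_
        rw [← smul_sub, norm_smul, Real.norm_of_nonneg (Real.exp_pos _).le, mul_assoc,
          mul_comm D]
        gcongr
        exact hvw s
    simp only [neg_zero, zero_mul, Real.exp_zero, mul_one, one_mul,
      intervalIntegral.integral_const_mul, hexp] at this
    rw [norm_smul, Real.norm_of_nonneg (Real.exp_pos _).le]
    calc _ ≤ Real.exp (-l * t) * (M * (K * D * ((Real.exp (l * t) - 1) / l))) := by gcongr
      _ ≤ Real.exp (-l * t) * (M * (K * D * (Real.exp (l * t) / l))) := by gcongr; linarith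
      _ = Real.exp (-l * t) * Real.exp (l * t) * (M * K / l * D) := by ring
      _ = M * K / l * D := by rw [← Real.exp_add]; simp
      _ ≤ 1 / 2 * D := by gcongr
  set F : BoundedContinuousFunction ℝ X → ℝ → X := fun u t => Real.exp (-l * max t 0) •
    (T (max t 0) x₀ + ∫ s in (0 : ℝ)..max t 0, T (max (max t 0 - s) 0)
      (g (Real.exp (l * s) • u s))) with hF
  have hFc : ∀ u, Continuous (F u) := by
    intro u
    have hcu : Continuous fun s => g (Real.exp (l * s) • u s) := hg.continuous.comp (by fun_prop)
    have h1 : Continuous fun t : ℝ => T (max t 0) x₀ :=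
      (hT.continuous_uncurry hM).comp (continuous_id.prodMk continuous_const)
    have h2 : Continuous fun t : ℝ => max t 0 := by fun_prop
    exact (by fun_prop : Continuous fun t : ℝ => Real.exp (-l * max t 0)).smul
      (h1.add ((hT.continuous_integral hM hcu).comp h2))
  have hFb : ∀ u t, ‖F u t‖ ≤ M * ‖x₀‖ + 1 / 2 * ‖u‖ := by
    intro u t
    have ht : 0 ≤ max t 0 := le_max_right _ _
    -- Comparison with the zero function, whose integral term vanishes since `g 0 = 0`.
    have h1 := hdiff u 0 ‖u‖ u.continuous continuous_zero (norm_nonneg _)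
      (fun s => by simpa using u.norm_coe_le_norm s) _ ht
    simp only [Pi.zero_apply, smul_zero, hg0, map_zero, intervalIntegral.integral_zero,
      sub_zero] at h1
    simp only [hF, smul_add]
    refine (norm_add_le _ _).trans (add_le_add ?_ h1)
    rw [norm_smul, Real.norm_of_nonneg (Real.exp_pos _).le]
    refine (mul_le_of_le_one_left (norm_nonneg _) (Real.exp_le_one_iff.2 ?_)).trans
      ((T _).le_of_opNorm_le (hM _ ht) _)
    nlinarith
  set Φ : BoundedContinuousFunction ℝ X → BoundedContinuousFunction ℝ X := fun u =>
    BoundedContinuousFunction.ofNormedAddCommGroup (F u) (hFc u) _ (hFb u) with hΦ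
  have hcontr : ContractingWith (1 / 2) Φ := by
    refine ⟨by norm_num, LipschitzWith.of_dist_le_mul fun u v => ?_⟩
    rw [BoundedContinuousFunction.dist_le (by positivity)]
    intro t
    have := hdiff u v (dist u v) u.continuous v.continuous dist_nonneg
      (fun s => by rw [← dist_eq_norm]; exact u.dist_coe_le_dist s) _ (le_max_right t 0)
    rw [dist_eq_norm]
    simpa [hΦ, hF, ← smul_sub] using this
  obtain ⟨u, hu⟩ : ∃ u, Φ u = u := ⟨_, hcontr.fixedPoint_isFixedPt⟩
  refine ⟨fun t => Real.exp (l * t) • u t, (by fun_prop : Continuous _).continuousOn,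
    fun t ht => ?_⟩
  have ht0 : (0 : ℝ) ≤ t := ht
  have hut : u t = F u t := (DFunLike.congr_fun hu t).symm
  rw [integral_semigroup_apply_eq_integral_max ht0]
  change Real.exp (l * t) • u t = _
  rw [hut]
  simp only [hF, max_eq_left ht0]
  rw [smul_smul, ← Real.exp_add]
  simp

end MildSolution

/-- Linearised stability: an exponentially stable semigroup perturbed by a locally Lipschitz
nonlinearity with vanishing Fréchet derivative at zero is locally exponentially stable. Neither the
inner product nor a Lyapunov operator enters the argument. -/
theorem IsC0Semigroup.isLocallyExpStable {𝕜 X : Type*} [RCLike 𝕜] [NormedAddCommGroup X]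
    [InnerProductSpace 𝕜 X] [NormedSpace ℝ X] [CompleteSpace X] {T : ℝ → X →L[𝕜] X}
    (hT : IsC0Semigroup T) (hstab : IsExpStableSemigroup T) {f : X → X} (hf : LocallyLipschitz f)
    (hf0 : f 0 = 0) (hf' : HasFDerivAt f (0 : X →L[𝕜] X) 0) : IsLocallyExpStable T f := by
  obtain ⟨M₀, ω, hω, hM₀⟩ := hstab
  set M := max M₀ 1 with hMdef
  have hM1 : 1 ≤ M := le_max_right _ _
  have hM0 : 0 < M := by linarith
  have hM : ∀ t, 0 ≤ t → ‖T t‖ ≤ M * Real.exp (-ω * t) := fun t ht =>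
    (hM₀ t ht).trans (by gcongr; exact le_max_left _ _)
  have hMb : ∀ t, 0 ≤ t → ‖T t‖ ≤ M := fun t ht =>
    (hM t ht).trans (mul_le_of_le_one_right hM0.le (Real.exp_le_one_iff.2 (by nlinarith)))
  -- Chosen so that half of the decay rate survives: `M * ε - ω = -(ω / 2)`.
  set ε := ω / (2 * M) with hε
  have hε0 : 0 < ε := by positivity
  have hrate : M * ε - ω = -(ω / 2) := by rw [hε]; field_simp; ring
  obtain ⟨K, U, hU, hfU⟩ := hf 0
  have hsmall : ∀ᶠ x in 𝓝 (0 : X), ‖f x‖ ≤ ε * ‖x‖ := by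
    simpa [hf0] using hf'.isLittleO.def hε0
  obtain ⟨r, hr, hball⟩ := Metric.nhds_basis_closedBall.mem_iff.1 (inter_mem hU hsmall)
  have hfr : ∀ x, ‖x‖ ≤ r → ‖f x‖ ≤ ε * ‖x‖ := fun x hx =>
    (hball (mem_closedBall_zero_iff.2 hx)).2
  have hfL : LipschitzOnWith K f (Metric.closedBall 0 r) :=
    hfU.mono fun x hx => (hball hx).1
  set g : X → X := fun x => f (radialRetraction r x) with hg
  have hgL : LipschitzWith (K * 2) g := by
    refine LipschitzWith.of_dist_le_mul fun x y => ?_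
    simp only [dist_eq_norm, hg]
    have := hfL.norm_sub_le
      (mem_closedBall_zero_iff.2 (norm_radialRetraction_le hr x))
      (mem_closedBall_zero_iff.2 (norm_radialRetraction_le hr y))
    push_cast
    rw [mul_assoc]
    exact this.trans (by gcongr; exact norm_radialRetraction_sub_le hr x y)
  have hg0 : g 0 = 0 := by simp [hg, radialRetraction, hf0]
  have hgε : ∀ x, ‖g x‖ ≤ ε * ‖x‖ := fun x =>
    (hfr _ (norm_radialRetraction_le hr x)).trans
      (by gcongr; exact norm_radialRetraction_le_norm hr x)
  -- This radius makes the a priori bound `M * ‖x₀‖` at most `r / 2`, strictly inside the ball of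
  -- radius `r`.
  refine ⟨r / (2 * M), M, ω / 2, by positivity, by positivity, fun x₀ hx₀ => ?_⟩
  have hMx₀ : M * ‖x₀‖ ≤ r / 2 := by
    have := (lt_div_iff₀ (by positivity)).1 hx₀
    linarith
  have hdecay : ∀ t : ℝ, 0 ≤ t → M * ‖x₀‖ * Real.exp (-(ω / 2) * t) ≤ r / 2 := fun t ht =>
    (mul_le_of_le_one_right (by positivity) (Real.exp_le_one_iff.2 (by nlinarith))).trans hMx₀
  obtain ⟨x, hx⟩ := exists_isMildSolution_of_lipschitzWith hT hMb hgL hg0 x₀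
  have hxnorm : ∀ t : ℝ, 0 ≤ t → ‖x t‖ ≤ M * ‖x₀‖ * Real.exp (-(ω / 2) * t) := fun t ht => by
    rw [← hrate]
    exact (hx.mono Icc_subset_Ici_self).norm_le hM hε0.le (fun s _ => hgε _) ⟨ht, le_rfl⟩
  have hxr : ∀ t : ℝ, 0 ≤ t → ‖x t‖ ≤ r := fun t ht => by
    linarith [hxnorm t ht, hdecay t ht]
  have hxf : IsMildSolution T f x₀ (Ici 0) x := by
    refine ⟨hx.1, fun t ht => ?_⟩
    have ht0 : (0 : ℝ) ≤ t := ht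
    rw [hx.2 t ht]
    congr 1
    refine intervalIntegral.integral_congr fun s hs => ?_
    rw [uIcc_of_le ht0] at hs
    simp only [hg, radialRetraction_of_norm_le hr (hxr s hs.1)]
  refine ⟨x, hxf, fun τ y hy t ht => ?_, fun t ht => ?_⟩
  · have hyt : IsMildSolution T f x₀ (Icc 0 t) y := hy.mono (Icc_subset_Ico_right ht.2)
    have hy0 : ‖y 0‖ ≤ r := by
      have : y 0 = x 0 := by
        rw [hyt.2 0 ⟨le_rfl, ht.1⟩, hxf.2 0 self_mem_Ici, intervalIntegral.integral_same,
          intervalIntegral.integral_same]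
      exact this ▸ hxr 0 le_rfl
    -- The estimate for `y` is available only while `y` stays in the ball; its improvement from `r`
    -- to `r / 2` closes the continuity argument.
    have hyr : ∀ s ∈ Icc 0 t, ‖y s‖ ≤ r :=
      norm_le_of_trapped (half_lt_self hr) hyt.1 hy0 fun s hs hsr => by
        have := (hyt.mono (Icc_subset_Icc_right hs.2)).norm_le hM hε0.le
          (fun s' hs' => hfr _ (hsr s' hs')) ⟨hs.1, le_rfl⟩
        rw [hrate] at this
        exact this.trans (hdecay s hs.1)
    exact hyt.eqOn hT hMb hf.continuous hfL (hxf.mono Icc_subset_Ici_self)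
      (fun s hs => mem_closedBall_zero_iff.2 (hyr s hs))
      (fun s hs => mem_closedBall_zero_iff.2 (hxr s hs.1)) ⟨ht.1, le_rfl⟩
  · exact (hxnorm t ht).trans_eq (by ring)

theorem theorem1p1 {𝕜 X : Type*} [RCLike 𝕜] [NormedAddCommGroup X] [InnerProductSpace 𝕜 X]
    [NormedSpace ℝ X] [IsScalarTower ℝ 𝕜 X] [CompleteSpace X]
    (A : X →ₗ.[𝕜] X) (T : ℝ → X →L[𝕜] X)
    (hT : IsC0Semigroup T) (hA : IsInfinitesimalGenerator A T) (hstab : IsExpStableSemigroup T)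
    (f : X → X) (hf : LocallyLipschitz f) (hf0 : f 0 = 0)
    (hf' : HasFDerivAt f (0 : X →L[𝕜] X) 0)
    (Q : X →L[𝕜] X) (hQ : IsSelfAdjoint Q) (hQinv : IsUnit Q) (ω : ℝ)
    (hω : ∀ x : A.domain,
      RCLike.re (inner 𝕜 (x : X) (Q (A x)) + inner 𝕜 (A x) (Q (x : X))) ≤ ω * ‖(x : X)‖ ^ 2) :
    IsLocallyExpStable T f :=
  hT.isLocallyExpStable hstab hf hf0 hf'
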